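/- Let $X$ be a finite set and let $S: X\times X\to X\times X$, $S(x,y)=(g_x(y),f_y(x))$, be a non-degenerate symmetric set-theoretic solution of the Yang–Baxter equation: all maps $f_x,g_x:X\to X$ are bijective, $S\circ S=\mathrm{Id}$, and $S^{12}S^{23}S^{12}=S^{23}S^{12}S^{23}$ on $X^3$. Let $G(X,S)$ be the group, and $M(X,S)$ the monoid, presented by $\langle X\mid xy=g_x(y)f_y(x)\ ;\ x,y\in X,\ S(x,y)\neq(x,y)\rangle$. Let $V$ be a real vector space with basis $X$, let $\psi:G(X,S)\to GL(V)$ be the representation with $\psi_x(y)=f_x^{-1}(y)$ for $y\in X$, $y\neq x$, and $\psi_x(x)=-f_x^{-1}(x)$, and put $W(X,S)=\psi(G(X,S))$ and $\mathbf X=\{\psi_x\mid x\in X\}$. *Terminology.* A Garside element of a monoid $M$ is an element whose sets of left and right divisors coincide and generate $M$; *the* Garside element is the least one for both left and right divisibility. For a group $W$ generated as a monoid by a subset $\mathbf X$, let $\ell(w)$ be the minimal length of a word on $\mathbf X$ representing $w$. If $w=uv$ with $\ell(w)=\ell(u)+\ell(v)$, then $u$ is a left $\mathbf X$-factor and $v$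 a right $\mathbf X$-factor of $w$; the element $w$ is $\mathbf X$-balanced if its sets of left and right $\mathbf X$-factors coincide, and this set is then denoted by $[1,w]$. For an $\mathbf X$-balanced $w$, the monoid $M_{w,\mathbf X}$ is generated by a copy $\{\underline v\mid v\in[1,w]\}$ of $[1,w]$, with the relations $\underline 1=1$, and $\underline v\,\underline{v'}=\underline{v''}$ whenever $v,v',v''\in[1,w]$, $vv'=v''$ and $\ell(v)+\ell(v')=\ell(v'')$. The pair $(W,\mathbf X)$ is a generating generated group for a monoid $M$, by means of $w$, if $W$ is finite, $\mathbf X$ generates $W$ as a monoid, $w\in W$ is $\mathbf X$-balanced, $[1,w]$ generates $W$, and $M\cong M_{w,\mathbf X}$. *Statement.* $W(X,S)$ is a finite quotient of $G(X,S)$, via $\psi$, and $(W(X,S),\mathbf X)$ is a generating generated group for $M(X,S)$. More precisely, $M(X,S)$ has a unique Garside element $\Delta$ that is least for both left and right divisibility, and $(W(X,S),\mathbf X)$ is a generating generated group for $M(X,S)$ by means of $\psi(\Delta)$; that is, $\psi(\Delta)$ is $\mathbf X$-balanced, $[1,\psi(\Delta)]$ generates $W(X,S)$, and $M_{\psi(\Delta),\mathbf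 X}\cong M(X,S)$. -/

import Mathlib

noncomputable section

namespace YangBaxter

/-! ### Garside elements of a monoid -/

section Garside

variable {M : Type*} [Monoid M]

/-- `f` is a left divisor of `g`. -/
def LeftDivides (f g : M) : Prop := ∃ h, g = f * h

/-- `f` is a right divisor of `g`. -/
def RightDivides (f g : M) : Prop := ∃ h, g = h * f

/-- A Garside element: its left and right divisors coincide and they generate the monoid. -/
structure IsGarsideElement (Δ : M) : Prop where
  balanced : {f | LeftDivides f Δ} = {f | RightDivides f Δ}
  generates : Submonoid.closure {f | LeftDivides f Δ} = ⊤

/-- The Garside element: the least Garside element, for both left and right divisibility. -/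
structure IsTheGarsideElement (Δ : M) : Prop where
  isGarside : IsGarsideElement Δ
  least_left : ∀ Δ', IsGarsideElement Δ' → LeftDivides Δ Δ'
  least_right : ∀ Δ', IsGarsideElement Δ' → RightDivides Δ Δ'

end Garside

/-! ### Generated groups and the monoids `M_{w,X}` -/

section Generated

variable {W : Type*} [Group W]

/-- The length of `w`: the least length of a word on `X` that represents `w`. -/
def wordLength (X : Set W) (w : W) : ℕ :=
  sInf {k | ∃ l : List W, (∀ a ∈ l, a ∈ X) ∧ l.prod = w ∧ l.length = k}

/-- The set of left `X`-factors of `w`. -/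
def leftFactors (X : Set W) (w : W) : Set W :=
  {u | ∃ v, w = u * v ∧ wordLength X w = wordLength X u + wordLength X v}

/-- The set of right `X`-factors of `w`. -/
def rightFactors (X : Set W) (w : W) : Set W :=
  {v | ∃ u, w = u * v ∧ wordLength X w = wordLength X u + wordLength X v}

/-- `w` is `X`-balanced. -/
def IsBalanced (X : Set W) (w : W) : Prop := leftFactors X w = rightFactors X w

/-- The defining relations of `M_{w,X}`, on a copy of the set of factors of `w`. The generator
attached to the neutral element of `W` is the neutral element of the monoid. -/
inductive FactorRel (X : Set W) (w : W) :
    FreeMonoid (leftFactors X w) → FreeMonoid (leftFactors X w) → Prop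
  | one (v : leftFactors X w) (h : (v : W) = 1) : FactorRel X w (FreeMonoid.of v) 1
  | mul (v v' v'' : leftFactors X w) (h : (v : W) * v' = v'')
      (hl : wordLength X (v : W) + wordLength X (v' : W) = wordLength X (v'' : W)) :
      FactorRel X w (FreeMonoid.of v * FreeMonoid.of v') (FreeMonoid.of v'')

/-- The monoid `M_{w,X}` (used for `X`-balanced `w`). -/
abbrev FactorMonoid (X : Set W) (w : W) : Type _ := PresentedMonoid (FactorRel X w)

/-- `(W, X)` is a generating generated group for the monoid `M`, by means of the element `w`. -/
structure IsGeneratingGeneratedGroupVia (X : Set W) (w : W) (M : Type*) [Monoid M] : Prop where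
  generated : Submonoid.closure X = ⊤
  finite : Finite W
  balanced : IsBalanced X w
  factors_generate : Subgroup.closure (leftFactors X w) = ⊤
  iso : Nonempty (FactorMonoid X w ≃* M)

/-- `(W, X)` is a generating generated group for the monoid `M`. -/
def IsGeneratingGeneratedGroup (X : Set W) (M : Type*) [Monoid M] : Prop :=
  ∃ w : W, IsGeneratingGeneratedGroupVia X w M

end Generated

/-! ### Set-theoretic solutions of the Yang-Baxter equation -/

section Solution

variable {X : Type*}

/-- `g_x (y)`, the first component of `S (x, y)`. -/
def gMap (S : X × X → X × X) (x y : X) : X := (S (x, y)).1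

/-- `f_x (y)`, the second component of `S (y, x)`; so `S (x, y) = (g_x (y), f_y (x))`. -/
def fMap (S : X × X → X × X) (x y : X) : X := (S (y, x)).2

/-- `S` acting on the first two components. -/
def act12 (S : X × X → X × X) (p : X × X × X) : X × X × X :=
  ((S (p.1, p.2.1)).1, (S (p.1, p.2.1)).2, p.2.2)

/-- `S` acting on the last two components. -/
def act23 (S : X × X → X × X) (p : X × X × X) : X × X × X := (p.1, S p.2)

/-- `(X, S)` is a non-degenerate symmetric (that is, involutive and braided) set-theoretic
solution of the Yang-Baxter equation. -/
structure IsNondegenerateSymmetric (S : X × X → X × X) : Prop where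
  bijective_g : ∀ x, Function.Bijective (gMap S x)
  bijective_f : ∀ x, Function.Bijective (fMap S x)
  involutive : Function.Involutive S
  braided : act12 S ∘ act23 S ∘ act12 S = act23 S ∘ act12 S ∘ act23 S

/-- The relators of the structure group. -/
def groupRels (S : X × X → X × X) : Set (FreeGroup X) :=
  {r | ∃ x y, S (x, y) ≠ (x, y) ∧
    r = (FreeGroup.of x * FreeGroup.of y) *
      (FreeGroup.of (gMap S x y) * FreeGroup.of (fMap S y x))⁻¹}

/-- The structure group `G(X,S)`. -/
abbrev StructureGroup (S : X × X → X × X) : Type _ := PresentedGroup (groupRels S)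

/-- The defining relations of the structure monoid. -/
inductive MonoidRel (S : X × X → X × X) : FreeMonoid X → FreeMonoid X → Prop
  | rel (x y : X) (h : S (x, y) ≠ (x, y)) :
      MonoidRel S (FreeMonoid.of x * FreeMonoid.of y)
        (FreeMonoid.of (gMap S x y) * FreeMonoid.of (fMap S y x))

/-- The monoid `M(X,S)`, with the same presentation as `G(X,S)`. -/
abbrev StructureMonoid (S : X × X → X × X) : Type _ := PresentedMonoid (MonoidRel S)

/-- The canonical morphism from `M(X,S)` to `G(X,S)`. -/
def monoidToGroup (S : X × X → X × X) : StructureMonoid S →* StructureGroup S :=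
  PresentedMonoid.lift (fun x => (PresentedGroup.of x : StructureGroup S)) <| by
    rintro _ _ ⟨x, y, h⟩
    have := PresentedGroup.one_of_mem (rels := groupRels S) ⟨x, y, h, rfl⟩
    rw [map_mul, map_inv, mul_inv_eq_one, map_mul, map_mul] at this
    exact this

/-! ### The signed permutation representation -/

variable {S : X × X → X × X} (hS : IsNondegenerateSymmetric S)

/-- `f_x` as a permutation of `X`. -/
def fPerm (x : X) : Equiv.Perm X := Equiv.ofBijective (fMap S x) (hS.bijective_f x)

/-- `φ_x`, the inverse of `f_x`. -/
def phi (x : X) : Equiv.Perm X := (fPerm hS x)⁻¹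

variable {V : Type*} [AddCommGroup V] [Module ℝ V] (b : Module.Basis X ℝ V)

open Classical in
/-- `ψ_x` as an element of `GL(V)`: it maps `x` to `-φ_x(x)` and every basis vector `y ≠ x`
to `φ_x(y)` (see the next lemma). -/
def psiGen (x : X) : LinearMap.GeneralLinearGroup ℝ V :=
  LinearMap.GeneralLinearGroup.ofLinearEquiv
    ((b.equiv (b.unitsSMul fun y => if y = x then -1 else 1) (Equiv.refl X)).trans
      (b.equiv b (phi hS x)))

open Classical in
theorem psiGen_apply (x y : X) :
    (psiGen hS b x : V →ₗ[ℝ] V) (b y) = (if y = x then -1 else 1 : ℝ) • b (phi hS x y) := by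
  change (b.equiv b (phi hS x))
    ((b.equiv (b.unitsSMul fun y => if y = x then -1 else 1) (Equiv.refl X)) (b y)) = _
  rw [Module.Basis.equiv_apply, Module.Basis.unitsSMul_apply]
  by_cases h : y = x <;> simp [h]

theorem fMap_fMap {S : X × X → X × X} (hS : IsNondegenerateSymmetric S) (x y z : X) :
    fMap S y (fMap S x z) = fMap S (fMap S y x) (fMap S (gMap S x y) z) := by
  have h := congrArg (fun p => p.2.2) (congrFun hS.braided (z, x, y))
  exact h

theorem fMap_gMap {S : X × X → X × X} (hS : IsNondegenerateSymmetric S) (x y : X) : fMap S (fMap S y x) (gMap S x y) = y :=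
  congrArg Prod.snd (hS.involutive (x, y))

theorem phi_phi (x y z : X) :
    phi hS x (phi hS y z) = phi hS (gMap S x y) (phi hS (fMap S y x) z) := by
  have h : fPerm hS y * fPerm hS x = fPerm hS (fMap S y x) * fPerm hS (gMap S x y) :=
    Equiv.ext fun u => fMap_fMap hS x y u
  have h' := congrArg (fun p => p⁻¹ z) h
  simpa [phi] using h'

theorem phi_eq_iff (x y z : X) : phi hS y z = x ↔ z = fMap S y x :=
  Equiv.Perm.inv_eq_iff_eq (f := fPerm hS y)

theorem psiGen_mul (x y : X) :
    psiGen hS b x * psiGen hS b y =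
      psiGen hS b (gMap S x y) * psiGen hS b (fMap S y x) := by
  classical
  apply Units.ext
  apply b.ext
  intro z
  rw [Units.val_mul, Units.val_mul, Module.End.mul_apply, Module.End.mul_apply]
  simp only [psiGen_apply, map_smul, smul_smul, phi_eq_iff, fMap_gMap hS x y]
  rw [phi_phi hS x y z, mul_comm]

/-- The representation `ψ : G(X,S) → GL(V)`. -/
def psi : StructureGroup S →* LinearMap.GeneralLinearGroup ℝ V :=
  PresentedGroup.toGroup (f := psiGen hS b) <| by
    rintro _ ⟨x, y, -, rfl⟩
    rw [map_mul, map_inv, mul_inv_eq_one, map_mul, map_mul]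
    simpa only [FreeGroup.lift_apply_of] using psiGen_mul hS b x y

/-- The group `W(X,S)`, the image of `ψ`. -/
abbrev WGroup : Subgroup (LinearMap.GeneralLinearGroup ℝ V) := (psi hS b).range

/-- `ψ` as a morphism from `G(X,S)` to `W(X,S)`. -/
def toW : StructureGroup S →* WGroup hS b := (psi hS b).rangeRestrict

/-- The generating set `{ψ_x ∣ x ∈ X}` of `W(X,S)`. -/
def psiSet : Set (WGroup hS b) := Set.range fun x : X => toW hS b (PresentedGroup.of x)

end Solution

end YangBaxter

end

noncomputable section

namespace YangBaxter

variable {X : Type*} {S : X × X → X × X} (hS : IsNondegenerateSymmetric S)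

namespace StructureMonoid

/-! Each element of the monoid has an exponent vector `val` in `X → ℕ`, with the twisted product
rule `val (m * n) = val m ∘ perm n + val n`. For finite `X` this is a bijection onto `X → ℕ`
(`val_injective`, `val_surjective`), so right divisibility becomes the pointwise order
(`rightDivides_iff`).

The image of `m` in `W(X,S)` is the signed permutation with underlying permutation `perm m` and
signs given by the parities of `val m` (`proj_apply_basis`). Hence `W(X,S)` is finite. Call `m`
square-free if `val m ≤ 1`: such an `m` is the unique lift of least degree of its image
(`eq_of_proj_eq`), and its degree is the word length of that image (`wordLength_proj`).

Let `Δ` have constant exponent 1. Its right divisors are the square-free elements, and counting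
shows that so are its left divisors (`leftDivides_iff_of_val_eq_one`). Any Garside element is a
multiple of every generator, hence of `Δ`. Length-additive factorizations of the image of `Δ` lift
to the monoid (`exists_mul_eq_of_mul_eq`), so its factors, with their partial product, are a copy of
the divisors of `Δ`. Since the nontrivial relations of `M(X,S)` only involve square-free products,
both presentations define the same monoid. -/

/-- The generator of the structure monoid attached to `x`. -/
def gen (S : X × X → X × X) (x : X) : StructureMonoid S := PresentedMonoid.of (MonoidRel S) x

theorem induction_right {p : StructureMonoid S → Prop} (m : StructureMonoid S) (one : p 1)
    (mul_gen : ∀ a x, p a → p (a * gen S x)) : p m := by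
  have hm : m ∈ Submonoid.closure (Set.range (PresentedMonoid.of (MonoidRel S))) := by
    rw [PresentedMonoid.closure_range_of]; trivial
  induction hm using Submonoid.closure_induction_right with
  | one => exact one
  | mul_right a _ y hy ih =>
    obtain ⟨x, rfl⟩ := hy
    exact mul_gen a x ih

theorem eq_one_or_mul_gen (m : StructureMonoid S) : m = 1 ∨ ∃ a x, m = a * gen S x :=
  induction_right (p := fun m => m = 1 ∨ ∃ a x, m = a * gen S x) m (Or.inl rfl)
    fun a x _ => Or.inr ⟨a, x, rfl⟩

theorem gen_mul_gen (x y : X) :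
    gen S x * gen S y = gen S (gMap S x y) * gen S (fMap S y x) := by
  by_cases h : S (x, y) = (x, y)
  · simp [gMap, fMap, h]
  · exact PresentedMonoid.mk_eq_mk_of_rel (MonoidRel.rel x y h)

theorem gMap_eq_phi (x y : X) : gMap S x y = phi hS (fMap S y x) y := by
  rw [eq_comm, phi_eq_iff, fMap_gMap hS]

/-- The defining relation, reparametrized by the last letters of its two sides: any `x` and `y` have
a common left multiple of degree 2. -/
theorem gen_phi_mul_gen (x y : X) :
    gen S (phi hS x y) * gen S x = gen S (phi hS y x) * gen S y := by
  have h : fMap S x (phi hS x y) = y := ((phi_eq_iff hS _ _ _).1 rfl).symm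
  rw [gen_mul_gen, gMap_eq_phi hS, h]

/-! ### Exponent vectors -/

/-- The permutation attached to an element of the structure monoid: `x` acts by `φ_x`. -/
def perm : StructureMonoid S →* Equiv.Perm X :=
  PresentedMonoid.lift (phi hS) <| by
    rintro _ _ ⟨x, y, h⟩
    simp only [map_mul, FreeMonoid.lift_eval_of]
    exact Equiv.ext fun z => phi_phi hS x y z

@[simp] theorem perm_gen (x : X) : perm hS (gen S x) = phi hS x := rfl

open Classical in
/-- The self-map `v ↦ v ∘ φ_x + e_x` of `X → ℕ`. -/
def actGen (x : X) : (Function.End (X → ℕ))ᵐᵒᵖ :=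
  MulOpposite.op fun v => v ∘ phi hS x + Pi.single x 1

open Classical in
/-- The right action of the structure monoid on `X → ℕ` in which `x` acts by
`v ↦ v ∘ φ_x + e_x`. -/
def act : StructureMonoid S →* (Function.End (X → ℕ))ᵐᵒᵖ :=
  PresentedMonoid.lift (actGen hS) <| by
    rintro _ _ ⟨x, y, h⟩
    simp only [map_mul, FreeMonoid.lift_eval_of, actGen]
    refine MulOpposite.unop_injective (funext fun v => funext fun z => ?_)
    change v (phi hS x (phi hS y z)) + (Pi.single x 1 : X → ℕ) (phi hS y z) +
        (Pi.single y 1 : X → ℕ) z =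
      v (phi hS (gMap S x y) (phi hS (fMap S y x) z)) +
        (Pi.single (gMap S x y) 1 : X → ℕ) (phi hS (fMap S y x) z) +
        (Pi.single (fMap S y x) 1 : X → ℕ) z
    simp only [Pi.single_apply, phi_eq_iff, fMap_gMap hS, phi_phi hS x y z]
    ring

/-- The exponent vector of an element of the structure monoid. -/
def val (m : StructureMonoid S) : X → ℕ := (act hS m).unop 0

-- The action is affine with linear part `v ↦ v ∘ perm m`; this yields the product rule `val_mul`.
open Classical in
theorem act_apply (m : StructureMonoid S) (v : X → ℕ) :
    (act hS m).unop v = v ∘ perm hS m + val hS m := by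
  unfold val
  induction m using induction_right generalizing v with
  | one =>
    rw [map_one, map_one]
    change v = v + 0
    simp
  | mul_gen a x ih =>
    rw [map_mul, map_mul, MulOpposite.unop_mul]
    change (act hS (gen S x)).unop ((act hS a).unop v) =
      _ + (act hS (gen S x)).unop ((act hS a).unop 0)
    rw [ih v]
    change (_ ∘ phi hS x + Pi.single x 1 : X → ℕ) = _ + (_ ∘ phi hS x + Pi.single x 1)
    funext z
    simp [add_assoc]

theorem val_mul (m n : StructureMonoid S) :
    val hS (m * n) = val hS m ∘ perm hS n + val hS n := by
  rw [← act_apply]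
  unfold val
  rw [map_mul]
  rfl

@[simp] theorem val_one : val hS (1 : StructureMonoid S) = 0 := by
  unfold val
  rw [map_one]
  rfl

open Classical in
@[simp] theorem val_gen (x : X) : val hS (gen S x) = Pi.single x 1 := by
  change ((0 : X → ℕ) ∘ phi hS x + Pi.single x 1 : X → ℕ) = _
  simp

theorem val_left_injective {m m' n : StructureMonoid S}
    (h : val hS (m * n) = val hS (m' * n)) : val hS m = val hS m' := by
  rw [val_mul, val_mul] at h
  exact (perm hS n).surjective.injective_comp_right (add_right_cancel h)

/-! ### Bijectivity of the exponent vector, and right divisibility -/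

section Degree

variable [Fintype X]

/-- The degree of an element of the structure monoid. -/
def degree (m : StructureMonoid S) : ℕ := ∑ x, val hS m x

theorem degree_mul (m n : StructureMonoid S) :
    degree hS (m * n) = degree hS m + degree hS n := by
  simp only [degree, val_mul, Pi.add_apply, Function.comp_apply, Finset.sum_add_distrib,
    Equiv.sum_comp (perm hS n) (val hS m)]

@[simp] theorem degree_one : degree hS (1 : StructureMonoid S) = 0 := by simp [degree]

@[simp] theorem degree_gen (x : X) : degree hS (gen S x) = 1 := by
  classical simp [degree]

theorem val_surjective : Function.Surjective (val hS) := by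
  classical
  suffices h : ∀ k (v : X → ℕ), ∑ x, v x = k → ∃ m, val hS m = v from fun v => h _ v rfl
  intro k
  induction k with
  | zero =>
    intro v hv
    refine ⟨1, ?_⟩
    funext x
    simpa using (Finset.sum_eq_zero_iff.1 hv x (Finset.mem_univ x)).symm
  | succ k ih =>
    intro v hv
    obtain ⟨x, -, hx⟩ : ∃ x ∈ Finset.univ, v x ≠ 0 := by
      by_contra! h
      rw [Finset.sum_eq_zero h] at hv
      omega
    have hle : Pi.single x 1 ≤ v := by
      intro z
      by_cases hz : z = x
      · subst hz; simp; omega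
      · simp [hz]
    -- Right multiplication by `x` composes with `φ_x` and adds `e_x`; the witness undoes both.
    obtain ⟨m, hm⟩ := ih ((v - Pi.single x 1 : X → ℕ) ∘ (phi hS x).symm) <| by
      have h1 : ∑ z, ((v - Pi.single x 1 : X → ℕ) z + (Pi.single x 1 : X → ℕ) z) = k + 1 := by
        rw [← hv]
        exact Finset.sum_congr rfl fun z _ => Nat.sub_add_cancel (hle z)
      rw [Finset.sum_add_distrib] at h1
      have h2 := Equiv.sum_comp (phi hS x).symm (v - Pi.single x 1 : X → ℕ)
      have h3 : ∑ z, (Pi.single x 1 : X → ℕ) z = 1 := by simp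
      simp only [Function.comp_apply]
      omega
    refine ⟨m * gen S x, ?_⟩
    rw [val_mul, hm, perm_gen, val_gen]
    funext z
    simpa using Nat.sub_add_cancel (hle z)

theorem exists_val_mul_eq {v : X → ℕ} {n : StructureMonoid S} (h : val hS n ≤ v) :
    ∃ u, val hS (u * n) = v := by
  obtain ⟨u, hu⟩ := val_surjective hS ((v - val hS n) ∘ (perm hS n).symm)
  refine ⟨u, ?_⟩
  rw [val_mul, hu]
  funext z
  simpa using Nat.sub_add_cancel (h z)

/-- Induction on the degree. Words with the same last letter are handled by cancellation; if the
last letters `x ≠ y` differ, both words can be made to end with the common left multiple of `x` and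
`y`. -/
theorem val_injective : Function.Injective (val hS) := by
  classical
  suffices h : ∀ k (m m' : StructureMonoid S), degree hS m = k → val hS m = val hS m' → m = m' from
    fun m m' => h _ m m' rfl
  intro k
  induction k using Nat.strong_induction_on with
  | _ k ih =>
    intro m m' hk hv
    have hd : degree hS m = degree hS m' := by simp only [degree, hv]
    rcases eq_one_or_mul_gen m with rfl | ⟨a, x, rfl⟩ <;>
      rcases eq_one_or_mul_gen m' with rfl | ⟨a', y, rfl⟩
    · rfl
    · simp [degree_mul] at hd
    · simp [degree_mul] at hd
    simp only [degree_mul, degree_gen] at hk hd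
    by_cases hxy : x = y
    · subst hxy
      rw [ih _ (by omega) a a' rfl (val_left_injective hS hv)]
    have hyx : Ne y x := fun h => hxy h.symm
    -- The exponent of `y` in `a * x` is that of `φ_x(y)` in `a`, so some product ending with
    -- `φ_x(y)` has the exponents of `a`; by induction it is `a`.
    have key : ∀ x y (a : StructureMonoid S), x ≠ y → degree hS a < k →
        1 ≤ val hS (a * gen S x) y → ∃ c, a = c * gen S (phi hS x y) := by
      intro x y a hxy hak hy
      obtain ⟨c, hc⟩ := exists_val_mul_eq hS (v := val hS a) (n := gen S (phi hS x y)) <| by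
        intro z
        by_cases hz : z = phi hS x y
        · subst hz
          simpa [val_mul, hxy.symm] using hy
        · simp [hz]
      exact ⟨c, ih _ hak a _ rfl hc.symm⟩
    obtain ⟨c, rfl⟩ := key x y a hxy (by omega) (by rw [hv]; simp [val_mul])
    obtain ⟨d, rfl⟩ := key y x a' hyx (by omega) (by rw [← hv]; simp [val_mul])
    rw [mul_assoc, mul_assoc, gen_phi_mul_gen hS x y] at hv ⊢
    simp only [degree_mul, degree_gen] at hk
    rw [ih _ (by omega) c d rfl (val_left_injective hS hv)]

theorem rightDivides_iff {m n : StructureMonoid S} :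
    RightDivides n m ↔ val hS n ≤ val hS m := by
  constructor
  · rintro ⟨u, rfl⟩
    rw [val_mul]
    exact le_add_of_nonneg_left zero_le
  · intro h
    obtain ⟨u, hu⟩ := exists_val_mul_eq hS h
    exact ⟨u, (val_injective hS hu).symm⟩

end Degree

end StructureMonoid

end YangBaxter

end

noncomputable section

namespace YangBaxter

section

variable {M : Type*} [Monoid M]

theorem LeftDivides.submonoid_closure {Δ : M} {s : Set M} (hs : Submonoid.closure s = ⊤)
    (h : ∀ a ∈ s, LeftDivides a Δ) : Submonoid.closure {f | LeftDivides f Δ} = ⊤ :=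
  top_le_iff.1 (hs ▸ Submonoid.closure_mono h)

end

variable {X : Type*} {S : X × X → X × X} (hS : IsNondegenerateSymmetric S)
variable {V : Type*} [AddCommGroup V] [Module ℝ V] (b : Module.Basis X ℝ V)

namespace StructureMonoid

/-! ### The signed permutation attached to an element of the monoid -/

/-- The morphism from the structure monoid to `W(X,S)`. -/
def proj : StructureMonoid S →* WGroup hS b := (toW hS b).comp (monoidToGroup S)

theorem coe_proj_gen (x : X) :
    (proj hS b (gen S x) : LinearMap.GeneralLinearGroup ℝ V) = psiGen hS b x :=
  PresentedGroup.toGroup.of _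

theorem proj_gen_mem (x : X) : proj hS b (gen S x) ∈ psiSet hS b := ⟨x, rfl⟩

theorem proj_apply_basis (m : StructureMonoid S) (z : X) :
    ((proj hS b m : LinearMap.GeneralLinearGroup ℝ V) : V →ₗ[ℝ] V) (b z) =
      (-1 : ℝ) ^ val hS m z • b (perm hS m z) := by
  classical
  induction m using induction_right generalizing z with
  | one => simp
  | mul_gen a x ih =>
    rw [map_mul, Subgroup.coe_mul, Units.val_mul, Module.End.mul_apply, coe_proj_gen,
      psiGen_apply, map_smul, ih, smul_smul, val_mul, map_mul, perm_gen, val_gen]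
    congr 1
    by_cases h : z = x
    · subst h; simp [pow_succ]
    · simp [h]

theorem val_mod_two_of_proj_eq {m m' : StructureMonoid S} (h : proj hS b m = proj hS b m') (z : X) :
    val hS m z % 2 = val hS m' z % 2 := by
  have h1 := proj_apply_basis hS b m z
  rw [h, proj_apply_basis] at h1
  -- This coordinate is a sign on the left, and would be zero on the right if the permutations
  -- differed at `z`.
  have h2 := congrArg (fun v => b.repr v (perm hS m z)) h1
  simp only [map_smul, Module.Basis.repr_self, Finsupp.smul_single, smul_eq_mul, mul_one,
    Finsupp.single_eq_same] at h2
  by_cases hp : perm hS m' z = perm hS m z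
  · rw [hp, Finsupp.single_eq_same] at h2
    rcases Nat.even_or_odd (val hS m z) with h3 | h3 <;>
      rcases Nat.even_or_odd (val hS m' z) with h4 | h4
    · rw [Nat.even_iff.1 h3, Nat.even_iff.1 h4]
    · rw [h3.neg_one_pow, h4.neg_one_pow] at h2; norm_num at h2
    · rw [h3.neg_one_pow, h4.neg_one_pow] at h2; norm_num at h2
    · rw [Nat.odd_iff.1 h3, Nat.odd_iff.1 h4]
  · rw [Finsupp.single_eq_of_ne' hp] at h2
    exact absurd h2.symm (pow_ne_zero _ (by norm_num))

/-- An exponent 0 or 1 is the least natural number of its parity. -/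
theorem val_le_of_proj_eq {m m' : StructureMonoid S} (hm : val hS m ≤ 1)
    (h : proj hS b m = proj hS b m') : val hS m ≤ val hS m' := by
  intro z
  have h1 := val_mod_two_of_proj_eq hS b h z
  have h2 : val hS m z ≤ 1 := hm z
  change val hS m z ≤ val hS m' z
  omega

section Finite

variable [Fintype X]

theorem eq_of_proj_eq {m m' : StructureMonoid S} (hm : val hS m ≤ 1)
    (h : proj hS b m = proj hS b m') (hd : degree hS m' ≤ degree hS m) : m = m' := by
  have hle := val_le_of_proj_eq hS b hm h
  refine val_injective hS (funext fun z => ?_)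
  exact (Finset.sum_eq_sum_iff_of_le fun z _ => hle z).1
    (le_antisymm (Finset.sum_le_sum fun z _ => hle z) hd) z (Finset.mem_univ z)

theorem eq_of_proj_eq_of_le_one {m m' : StructureMonoid S} (hm : val hS m ≤ 1)
    (hm' : val hS m' ≤ 1) (h : proj hS b m = proj hS b m') : m = m' :=
  val_injective hS (le_antisymm (val_le_of_proj_eq hS b hm h)
    (val_le_of_proj_eq hS b hm' h.symm))

omit [Fintype X] in
theorem proj_eq_of_val_of_perm {m m' : StructureMonoid S}
    (hv : ∀ z, Even (val hS m z) ↔ Even (val hS m' z)) (hp : perm hS m = perm hS m') :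
    proj hS b m = proj hS b m' := by
  refine Subtype.ext (Units.ext (b.ext fun z => ?_))
  rw [proj_apply_basis, proj_apply_basis, hp]
  by_cases h : Even (val hS m z)
  · rw [h.neg_one_pow, ((hv z).1 h).neg_one_pow]
  · rw [(Nat.not_even_iff_odd.1 h).neg_one_pow,
      (Nat.not_even_iff_odd.1 (mt (hv z).2 h)).neg_one_pow]

theorem finite_range_proj : (Set.range (proj hS b)).Finite := by
  let k : StructureMonoid S → (X → Prop) × Equiv.Perm X :=
    fun m => (fun z => Even (val hS m z), perm hS m)
  have hk : (proj hS b : StructureMonoid S → WGroup hS b).FactorsThrough k := fun m m' h =>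
    proj_eq_of_val_of_perm hS b (fun z => iff_of_eq (congrFun (congrArg Prod.fst h) z))
      (congrArg Prod.snd h)
  -- The image depends only on parities and permutation, which take finitely many values; the
  -- default value 1 off the range of `k` is immaterial.
  refine (Set.finite_range (Function.extend k (proj hS b) 1)).subset ?_
  rintro _ ⟨m, rfl⟩
  exact ⟨k m, hk.extend_apply 1 m⟩

omit [Fintype X] in
theorem subgroup_closure_psiSet : Subgroup.closure (psiSet hS b) = ⊤ := by
  have h : psiSet hS b = toW hS b '' Set.range PresentedGroup.of := by
    rw [← Set.range_comp]; rfl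
  rw [h, ← MonoidHom.map_closure, PresentedGroup.closure_range_of, ← MonoidHom.range_eq_map]
  exact MonoidHom.range_eq_top.2 (MonoidHom.rangeRestrict_surjective _)

/-- Inverses are not needed: the powers of a generator lie in the finite range of `proj`, so each
generator has finite order. -/
theorem submonoid_closure_psiSet : Submonoid.closure (psiSet hS b) = ⊤ := by
  rw [← Subgroup.closure_toSubmonoid_of_isOfFinOrder, subgroup_closure_psiSet]
  · rfl
  rintro _ ⟨x, rfl⟩
  rw [← finite_powers]
  refine (finite_range_proj hS b).subset ?_
  rintro _ ⟨k, rfl⟩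
  exact ⟨gen S x ^ k, map_pow _ _ _⟩

/-! ### Word length in the group and degree in the monoid -/

theorem exists_proj_eq_of_list (l : List (WGroup hS b)) (hl : ∀ a ∈ l, a ∈ psiSet hS b) :
    ∃ m, proj hS b m = l.prod ∧ degree hS m = l.length := by
  induction l with
  | nil => exact ⟨1, by simp⟩
  | cons a l ih =>
    obtain ⟨m, hm, hd⟩ := ih fun c hc => hl c (List.mem_cons_of_mem a hc)
    obtain ⟨x, rfl⟩ := hl a List.mem_cons_self
    refine ⟨gen S x * m, ?_, ?_⟩
    · rw [map_mul, hm, List.prod_cons]; rfl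
    · rw [degree_mul, degree_gen, hd, List.length_cons, add_comm]

theorem exists_list_eq_proj (m : StructureMonoid S) :
    ∃ l : List (WGroup hS b), (∀ a ∈ l, a ∈ psiSet hS b) ∧ l.prod = proj hS b m ∧
      l.length = degree hS m := by
  induction m using induction_right with
  | one => exact ⟨[], by simp⟩
  | mul_gen a x ih =>
    obtain ⟨l, hl, hp, hd⟩ := ih
    refine ⟨l ++ [proj hS b (gen S x)], ?_, by simp [hp], by simp [hd, degree_mul]⟩
    intro c hc
    rcases List.mem_append.1 hc with hc | hc
    · exact hl c hc
    · exact List.mem_singleton.1 hc ▸ proj_gen_mem hS b x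

theorem wordLength_proj_le (m : StructureMonoid S) :
    wordLength (psiSet hS b) (proj hS b m) ≤ degree hS m :=
  Nat.sInf_le (exists_list_eq_proj hS b m)

theorem exists_proj_eq_degree_eq (w : WGroup hS b) :
    ∃ m, proj hS b m = w ∧ degree hS m = wordLength (psiSet hS b) w := by
  have hw : w ∈ Submonoid.closure (psiSet hS b) := by
    rw [submonoid_closure_psiSet]; trivial
  obtain ⟨l, hl, rfl⟩ := Submonoid.exists_list_of_mem_closure hw
  obtain ⟨l', hl', hp, hk⟩ := Nat.sInf_mem
    (s := {k | ∃ l' : List (WGroup hS b), (∀ a ∈ l', a ∈ psiSet hS b) ∧ l'.prod = l.prod ∧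
      l'.length = k}) ⟨_, l, hl, rfl, rfl⟩
  obtain ⟨m, hm, hd⟩ := exists_proj_eq_of_list hS b l' hl'
  exact ⟨m, hm.trans hp, hd.trans hk⟩

theorem finite_WGroup : Finite (WGroup hS b) :=
  Set.finite_univ_iff.1 <| (finite_range_proj hS b).subset fun w _ =>
    (exists_proj_eq_degree_eq hS b w).imp fun _ h => h.1

theorem wordLength_proj {m : StructureMonoid S} (hm : val hS m ≤ 1) :
    wordLength (psiSet hS b) (proj hS b m) = degree hS m := by
  refine le_antisymm (wordLength_proj_le hS b m) ?_
  obtain ⟨m', h, hd⟩ := exists_proj_eq_degree_eq hS b (proj hS b m)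
  rw [← hd]
  exact Finset.sum_le_sum fun z _ => val_le_of_proj_eq hS b hm h.symm z

/-! ### The Garside element -/

omit [Fintype X] in
theorem val_le_one_of_mul_left {u n : StructureMonoid S} (h : val hS (u * n) ≤ 1) :
    val hS u ≤ 1 := by
  intro z
  have h1 := h ((perm hS n).symm z)
  rw [val_mul] at h1
  simp only [Pi.add_apply, Function.comp_apply, Equiv.apply_symm_apply] at h1
  exact (Nat.le_add_right _ _).trans h1

omit [Fintype X] in
theorem val_le_one_of_mul_right {u n : StructureMonoid S} (h : val hS (u * n) ≤ 1) :
    val hS n ≤ 1 := by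
  rw [val_mul] at h
  exact le_trans (le_add_of_nonneg_left zero_le) h

-- Right complementation in `Δ` is an injective self-map of the finite set of square-free elements,
-- because cancellation holds in `W(X,S)` and square-free elements are determined by their images.
-- It is therefore surjective, so every square-free element is a left divisor.
include b in
theorem leftDivides_iff_of_val_eq_one {Δ : StructureMonoid S} (hΔ : val hS Δ = 1)
    (s : StructureMonoid S) : LeftDivides s Δ ↔ val hS s ≤ 1 := by
  constructor
  · rintro ⟨n, rfl⟩
    exact val_le_one_of_mul_left hS hΔ.le
  intro hs
  let D := {n : StructureMonoid S // val hS n ≤ 1}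
  have : Finite D := by
    have hf : (Set.Iic (1 : X → ℕ)).Finite := by classical exact Set.finite_Iic _
    exact (hf.preimage (val_injective hS).injOn).to_subtype
  have hc : ∀ n : D, ∃ u : D, (u : StructureMonoid S) * n = Δ := by
    rintro ⟨n, hn⟩
    obtain ⟨u, hu⟩ := (rightDivides_iff hS).2 (hΔ ▸ hn : val hS n ≤ val hS Δ)
    exact ⟨⟨u, val_le_one_of_mul_left hS (n := n) (hu ▸ hΔ.le)⟩, hu.symm⟩
  choose c hc using hc
  have hinj : Function.Injective c := by
    intro n n' h
    have h1 : proj hS b (c n * n) = proj hS b (c n * n') := by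
      rw [hc, h, hc]
    rw [map_mul, map_mul] at h1
    exact Subtype.ext (eq_of_proj_eq_of_le_one hS b n.2 n'.2 (mul_left_cancel h1))
  obtain ⟨n, hn⟩ := Finite.surjective_of_injective hinj ⟨s, hs⟩
  refine ⟨n, ?_⟩
  have h := hc n
  rw [hn] at h
  exact h.symm

omit [Fintype X] in
theorem closure_range_gen : Submonoid.closure (Set.range (gen S)) = ⊤ :=
  PresentedMonoid.closure_range_of _

omit [Fintype X] in
theorem val_gen_le_one (x : X) : val hS (gen S x) ≤ 1 := by
  classical
  intro z
  rw [val_gen]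
  by_cases h : z = x
  · subst h; simp
  · simp [h]

-- The product `x y` fails to be square-free only if `f_y(x) = y`; involutivity and injectivity of
-- `f_y` then force `g_x(y) = x`, a trivial relation.
omit [Fintype X] in
theorem val_gen_mul_gen_le_one {x y : X} (h : S (x, y) ≠ (x, y)) :
    val hS (gen S x * gen S y) ≤ 1 := by
  classical
  have hxy : y ≠ fMap S y x := by
    intro he
    refine h (Prod.ext ?_ he.symm)
    refine (hS.bijective_f y).injective ?_
    have h1 := fMap_gMap hS x y
    rw [← he] at h1
    exact h1.trans he
  intro z
  rw [val_mul, perm_gen, val_gen, val_gen]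
  simp only [Pi.add_apply, Function.comp_apply, Pi.single_apply, phi_eq_iff, Pi.one_apply]
  split_ifs with h1 h2 h2
  · exact absurd (h2.symm.trans h1) hxy
  all_goals simp

include b in
theorem isGarsideElement_of_val_eq_one {Δ : StructureMonoid S} (hΔ : val hS Δ = 1) :
    IsGarsideElement Δ where
  balanced := by
    ext s
    exact (leftDivides_iff_of_val_eq_one hS b hΔ s).trans
      (hΔ ▸ (rightDivides_iff hS (m := Δ)).symm)
  generates := LeftDivides.submonoid_closure closure_range_gen <| by
    rintro _ ⟨x, rfl⟩
    exact (leftDivides_iff_of_val_eq_one hS b hΔ _).2 (val_gen_le_one hS x)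

include hS in
/-- A generating set of the structure monoid contains all the generators `x ∈ X`. -/
theorem gen_mem_of_closure_eq_top {s : Set (StructureMonoid S)} (h : Submonoid.closure s = ⊤)
    (x : X) : gen S x ∈ s := by
  -- Degree is additive and vanishes only at 1, so an element of degree 1 has no proper
  -- factorization.
  have key : ∀ m ∈ Submonoid.closure s, degree hS m = 1 → m ∈ s := by
    intro m hm
    induction hm using Submonoid.closure_induction with
    | mem y hy => exact fun _ => hy
    | one => simp
    | mul y z _ _ hy hz =>
      intro hd
      have one_of {a : StructureMonoid S} (ha : degree hS a = 0) : a = 1 := by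
        refine val_injective hS (funext fun z => ?_)
        simpa using Finset.sum_eq_zero_iff.1 ha z (Finset.mem_univ z)
      rw [degree_mul] at hd
      rcases Nat.add_eq_one_iff.1 hd with ⟨h0, h1⟩ | ⟨h1, h0⟩
      · rw [one_of h0, one_mul]; exact hz h1
      · rw [one_of h0, mul_one]; exact hy h1
  exact key _ (h ▸ Submonoid.mem_top _) (degree_gen hS x)

theorem one_le_val_of_isGarsideElement {Δ : StructureMonoid S} (h : IsGarsideElement Δ) :
    1 ≤ val hS Δ := by
  classical
  intro x
  have h1 : RightDivides (gen S x) Δ := by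
    have := gen_mem_of_closure_eq_top hS h.generates x
    rwa [h.balanced] at this
  simpa using (rightDivides_iff hS).1 h1 x

include b in
theorem isTheGarsideElement_of_val_eq_one {Δ : StructureMonoid S} (hΔ : val hS Δ = 1) :
    IsTheGarsideElement Δ where
  isGarside := isGarsideElement_of_val_eq_one hS b hΔ
  least_left Δ' h := by
    have h1 : Δ ∈ {f | RightDivides f Δ'} :=
      (rightDivides_iff hS).2 (hΔ ▸ one_le_val_of_isGarsideElement hS h)
    rwa [← h.balanced] at h1
  least_right Δ' h := (rightDivides_iff hS).2 (hΔ ▸ one_le_val_of_isGarsideElement hS h)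

include b in
theorem isTheGarsideElement_iff {Δ : StructureMonoid S} :
    IsTheGarsideElement Δ ↔ val hS Δ = 1 := by
  refine ⟨fun h => ?_, isTheGarsideElement_of_val_eq_one hS b⟩
  obtain ⟨Δ', hΔ'⟩ := val_surjective hS 1
  exact le_antisymm
    (hΔ' ▸ (rightDivides_iff hS).1 (h.least_right _ (isGarsideElement_of_val_eq_one hS b hΔ')))
    (one_le_val_of_isGarsideElement hS h.isGarside)

/-! ### Factors of the image of the Garside element -/

/-- Lift `u` and `v` by shortest words: the product of the lifts has the image and the degree of
`m`, and a square-free element is the only lift of its degree. -/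
theorem exists_mul_eq_of_mul_eq {m : StructureMonoid S} (hm : val hS m ≤ 1) {u v : WGroup hS b}
    (h : proj hS b m = u * v)
    (hl : wordLength (psiSet hS b) (proj hS b m) =
      wordLength (psiSet hS b) u + wordLength (psiSet hS b) v) :
    ∃ s t, proj hS b s = u ∧ proj hS b t = v ∧ m = s * t := by
  obtain ⟨s, rfl, hs⟩ := exists_proj_eq_degree_eq hS b u
  obtain ⟨t, rfl, ht⟩ := exists_proj_eq_degree_eq hS b v
  refine ⟨s, t, rfl, rfl, eq_of_proj_eq hS b hm (by rw [h, map_mul]) ?_⟩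
  rw [degree_mul, hs, ht, ← hl, wordLength_proj hS b hm]

theorem wordLength_proj_mul {s t : StructureMonoid S} (h : val hS (s * t) ≤ 1) :
    wordLength (psiSet hS b) (proj hS b (s * t)) =
      wordLength (psiSet hS b) (proj hS b s) + wordLength (psiSet hS b) (proj hS b t) := by
  rw [wordLength_proj hS b h, wordLength_proj hS b (val_le_one_of_mul_left hS h),
    wordLength_proj hS b (val_le_one_of_mul_right hS h), degree_mul]

variable {Δ : StructureMonoid S} (hΔ : val hS Δ = 1)
include hΔ

theorem mem_leftFactors_iff {u : WGroup hS b} :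
    u ∈ leftFactors (psiSet hS b) (proj hS b Δ) ↔ ∃ s, val hS s ≤ 1 ∧ proj hS b s = u := by
  constructor
  · rintro ⟨v, h, hl⟩
    obtain ⟨s, t, hs, -, rfl⟩ := exists_mul_eq_of_mul_eq hS b hΔ.le h hl
    exact ⟨s, val_le_one_of_mul_left hS hΔ.le, hs⟩
  · rintro ⟨s, hs, rfl⟩
    obtain ⟨t, rfl⟩ := (leftDivides_iff_of_val_eq_one hS b hΔ s).2 hs
    exact ⟨proj hS b t, map_mul _ _ _, wordLength_proj_mul hS b hΔ.le⟩

theorem mem_rightFactors_iff {u : WGroup hS b} :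
    u ∈ rightFactors (psiSet hS b) (proj hS b Δ) ↔ ∃ s, val hS s ≤ 1 ∧ proj hS b s = u := by
  constructor
  · rintro ⟨v, h, hl⟩
    obtain ⟨s, t, -, ht, rfl⟩ := exists_mul_eq_of_mul_eq hS b hΔ.le h hl
    exact ⟨t, val_le_one_of_mul_right hS hΔ.le, ht⟩
  · rintro ⟨s, hs, rfl⟩
    obtain ⟨t, rfl⟩ := (rightDivides_iff hS).2 (hΔ ▸ hs : val hS s ≤ val hS Δ)
    exact ⟨proj hS b t, map_mul _ _ _, wordLength_proj_mul hS b hΔ.le⟩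

theorem isBalanced_proj : IsBalanced (psiSet hS b) (proj hS b Δ) :=
  Set.ext fun _ => (mem_leftFactors_iff hS b hΔ).trans (mem_rightFactors_iff hS b hΔ).symm

theorem closure_leftFactors :
    Subgroup.closure (leftFactors (psiSet hS b) (proj hS b Δ)) = ⊤ := by
  rw [← top_le_iff, ← subgroup_closure_psiSet hS b]
  refine Subgroup.closure_mono ?_
  rintro _ ⟨x, rfl⟩
  exact (mem_leftFactors_iff hS b hΔ).2 ⟨gen S x, val_gen_le_one hS x, rfl⟩

/-- The factor of the image of the Garside element attached to a divisor of the latter. -/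
def factor (s : StructureMonoid S) (hs : val hS s ≤ 1) :
    leftFactors (psiSet hS b) (proj hS b Δ) :=
  ⟨proj hS b s, (mem_leftFactors_iff hS b hΔ).2 ⟨s, hs, rfl⟩⟩

/-- The element of the structure monoid with square-free exponent vector that lifts a factor of
the image of the Garside element. -/
def liftFactor (u : leftFactors (psiSet hS b) (proj hS b Δ)) : StructureMonoid S :=
  ((mem_leftFactors_iff hS b hΔ).1 u.2).choose

theorem val_liftFactor_le (u : leftFactors (psiSet hS b) (proj hS b Δ)) :
    val hS (liftFactor hS b hΔ u) ≤ 1 :=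
  ((mem_leftFactors_iff hS b hΔ).1 u.2).choose_spec.1

theorem proj_liftFactor (u : leftFactors (psiSet hS b) (proj hS b Δ)) :
    proj hS b (liftFactor hS b hΔ u) = u :=
  ((mem_leftFactors_iff hS b hΔ).1 u.2).choose_spec.2

theorem liftFactor_eq {u : leftFactors (psiSet hS b) (proj hS b Δ)} {s : StructureMonoid S}
    (hs : val hS s ≤ 1) (h : proj hS b s = u) : liftFactor hS b hΔ u = s :=
  eq_of_proj_eq_of_le_one hS b (val_liftFactor_le hS b hΔ u) hs
    ((proj_liftFactor hS b hΔ u).trans h.symm)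

/-- The morphism from the factor monoid to the structure monoid. -/
def ofFactorMonoid : FactorMonoid (psiSet hS b) (proj hS b Δ) →* StructureMonoid S :=
  PresentedMonoid.lift (liftFactor hS b hΔ) <| by
    rintro _ _ (⟨v, h⟩ | ⟨v, v', v'', h, hl⟩)
    · rw [FreeMonoid.lift_eval_of, map_one]
      exact liftFactor_eq hS b hΔ (by rw [val_one]; exact zero_le) (by rw [map_one, h])
    · rw [map_mul, FreeMonoid.lift_eval_of, FreeMonoid.lift_eval_of, FreeMonoid.lift_eval_of]
      refine (eq_of_proj_eq hS b (val_liftFactor_le hS b hΔ v'') ?_ ?_).symm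
      · simp only [map_mul, proj_liftFactor, h]
      · rw [degree_mul, ← wordLength_proj hS b (val_liftFactor_le hS b hΔ v),
          ← wordLength_proj hS b (val_liftFactor_le hS b hΔ v'),
          ← wordLength_proj hS b (val_liftFactor_le hS b hΔ v'')]
        simp only [proj_liftFactor, hl, le_refl]

theorem of_factor_mul {s t : StructureMonoid S} (h : val hS (s * t) ≤ 1) :
    PresentedMonoid.of (FactorRel (psiSet hS b) (proj hS b Δ))
        (factor hS b hΔ s (val_le_one_of_mul_left hS h)) *
      PresentedMonoid.of _ (factor hS b hΔ t (val_le_one_of_mul_right hS h)) =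
    PresentedMonoid.of _ (factor hS b hΔ (s * t) h) :=
  PresentedMonoid.mk_eq_mk_of_rel <|
    FactorRel.mul _ _ _ (map_mul (proj hS b) s t).symm (wordLength_proj_mul hS b h).symm

/-- The morphism from the structure monoid to the factor monoid. -/
def toFactorMonoid : StructureMonoid S →* FactorMonoid (psiSet hS b) (proj hS b Δ) :=
  PresentedMonoid.lift
    (fun x => PresentedMonoid.of _ (factor hS b hΔ (gen S x) (val_gen_le_one hS x))) <| by
    rintro _ _ ⟨x, y, h⟩
    -- Both sides of a nontrivial relation are square-free, so each is a single generator of the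
    -- factor monoid.
    have h1 := val_gen_mul_gen_le_one hS h
    have h2 := h1
    rw [gen_mul_gen] at h2
    simp only [map_mul, FreeMonoid.lift_eval_of]
    rw [of_factor_mul hS b hΔ h1, of_factor_mul hS b hΔ h2]
    congr 2
    exact gen_mul_gen x y

/-- Left divisors of a square-free element are square-free, so its letters can be multiplied one at
a time inside the set of factors. -/
theorem toFactorMonoid_of_le_one {s : StructureMonoid S} (hs : val hS s ≤ 1) :
    toFactorMonoid hS b hΔ s = PresentedMonoid.of _ (factor hS b hΔ s hs) := by
  induction s using induction_right with
  | one =>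
    rw [map_one]
    exact (PresentedMonoid.mk_eq_mk_of_rel (FactorRel.one _ (map_one (proj hS b)))).symm
  | mul_gen a x ih =>
    rw [map_mul, ih (val_le_one_of_mul_left hS hs), ← of_factor_mul hS b hΔ hs]
    rfl

/-- The factor monoid of the image of the Garside element is the structure monoid. -/
def factorMonoidEquiv : FactorMonoid (psiSet hS b) (proj hS b Δ) ≃* StructureMonoid S :=
  MonoidHom.toMulEquiv (ofFactorMonoid hS b hΔ) (toFactorMonoid hS b hΔ)
    (by
      refine PresentedMonoid.ext _ fun u => ?_
      change toFactorMonoid hS b hΔ (liftFactor hS b hΔ u) = PresentedMonoid.of _ u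
      rw [toFactorMonoid_of_le_one hS b hΔ (val_liftFactor_le hS b hΔ u)]
      congr 1
      exact Subtype.ext (proj_liftFactor hS b hΔ u))
    (by
      refine PresentedMonoid.ext _ fun x => ?_
      exact liftFactor_eq hS b hΔ (val_gen_le_one hS x) rfl)

theorem isGeneratingGeneratedGroupVia :
    IsGeneratingGeneratedGroupVia (psiSet hS b) (proj hS b Δ) (StructureMonoid S) where
  generated := submonoid_closure_psiSet hS b
  finite := finite_WGroup hS b
  balanced := isBalanced_proj hS b hΔ
  factors_generate := closure_leftFactors hS b hΔ
  iso := ⟨factorMonoidEquiv hS b hΔ⟩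

end Finite

end StructureMonoid

end YangBaxter

end

theorem mainTheorem1 {X : Type*} [Finite X] (S : X × X → X × X)
    (hS : YangBaxter.IsNondegenerateSymmetric S)
    {V : Type*} [AddCommGroup V] [Module ℝ V] (b : Module.Basis X ℝ V) :
    Finite (YangBaxter.WGroup hS b) ∧
    Function.Surjective (YangBaxter.toW hS b) ∧
    YangBaxter.IsGeneratingGeneratedGroup (YangBaxter.psiSet hS b)
      (YangBaxter.StructureMonoid S) ∧
    (∃! Δ : YangBaxter.StructureMonoid S, YangBaxter.IsTheGarsideElement Δ) ∧
    ∀ Δ : YangBaxter.StructureMonoid S, YangBaxter.IsTheGarsideElement Δ →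
      YangBaxter.IsGeneratingGeneratedGroupVia (YangBaxter.psiSet hS b)
        (YangBaxter.toW hS b (YangBaxter.monoidToGroup S Δ)) (YangBaxter.StructureMonoid S) := by
  have := Fintype.ofFinite X
  obtain ⟨Δ, hΔ⟩ := YangBaxter.StructureMonoid.val_surjective hS 1
  have hiff (Δ : YangBaxter.StructureMonoid S) :=
    YangBaxter.StructureMonoid.isTheGarsideElement_iff hS b (Δ := Δ)
  refine ⟨YangBaxter.StructureMonoid.finite_WGroup hS b, MonoidHom.rangeRestrict_surjective _,
    ⟨_, YangBaxter.StructureMonoid.isGeneratingGeneratedGroupVia hS b hΔ⟩,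
    ⟨Δ, (hiff Δ).2 hΔ, fun Δ' h => ?_⟩, fun Δ' h => ?_⟩
  · exact YangBaxter.StructureMonoid.val_injective hS (((hiff Δ').1 h).trans hΔ.symm)
  · exact YangBaxter.StructureMonoid.isGeneratingGeneratedGroupVia hS b ((hiff Δ').1 h)
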